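/- Let $\mathcal{E}$ be a finite-dimensional real inner product space and let $\mathcal{M}\subseteq\mathcal{E}$ be a compact smooth ($C^\infty$) embedded submanifold, with tangent spaces $\mathrm{T}_x\mathcal{M}\subseteq\mathcal{E}$, orthogonal projectors $\mathrm{Proj}_x\colon\mathcal{E}\to\mathrm{T}_x\mathcal{M}$, and the Riemannian metric inherited from $\mathcal{E}$. Let $\mathrm{Retr}\colon\mathrm{T}\mathcal{M}\to\mathcal{M}$ be a second-order retraction, that is, a smooth map on the whole tangent bundle such that, for all $x\in\mathcal{M}$ and $\eta\in\mathrm{T}_x\mathcal{M}$, with $\mathrm{Retr}_x=\mathrm{Retr}|_{\mathrm{T}_x\mathcal{M}}$, $$\mathrm{Retr}_x(0)=x,\qquad \mathrm{D}\mathrm{Retr}_x(0)=\mathrm{Id},\qquad \frac{\mathrm{D}^2}{\mathrm{d}t^2}\mathrm{Retr}_x(t\eta)\Big|_{t=0}=0,$$ where the Riemannian acceleration of a curve $c$ on $\mathcal{M}$ is $\frac{\mathrm{D}^2}{\mathrm{d}t^2}c(t)=\mathrm{Proj}_{c(t)}\,c''(t)$. Let $f\colon\mathcal{E}\to\mathbb{R}$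 be twice differentiable at every point of the convex hull of $\mathcal{M}$ (that is, differentiable near the point, with gradient $\nabla f$ differentiable at the point), and let its Hessian $\nabla^2 f$ be Lipschitz continuous on this convex hull. For $x\in\mathcal{M}$ let $\hat f_x=f\circ\mathrm{Retr}_x\colon\mathrm{T}_x\mathcal{M}\to\mathbb{R}$ be the pullback, let $\mathrm{grad} f(x)\in\mathrm{T}_x\mathcal{M}$ be the Riemannian gradient of $f|_{\mathcal{M}}$, and let $\mathrm{Hess} f(x)[\eta]=\mathrm{Proj}_x\big(\mathrm{D}(\mathrm{grad} f)(x)[\eta]\big)$ be its Riemannian Hessian. Then there is a constant $\bar L\ge 0$, independent of $x$, such that for every $x\in\mathcal{M}$ the pullback $\hat f_x$ is twice differentiable at $0$, the vector field $\mathrm{grad} f$ is differentiable along $\mathcal{M}$ at $x$, $\nabla^2\hat f_x(0)=\mathrm{Hess} f(x)$, and for all $\eta\in\mathrm{T}_x\mathcal{M}$ $$\left|\hat f_x(\eta)-\left[f(x)+\langle\eta,\mathrm{grad} f(x)\rangle+\tfrac12\langle\eta,\nabla^2\hat f_x(0)[\eta]\rangle\right]\right|\le\frac{\bar L}{6}\|\eta\|^3.$$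 -/

import Mathlib

open Set Filter Topology
open scoped ContDiff

noncomputable section

namespace RiemSub

section Hilbert

variable {F : Type*} [NormedAddCommGroup F] [InnerProductSpace ℝ F] [CompleteSpace F]

/-- `g` is twice (Fréchet) differentiable at `x`: it is differentiable near `x`, and its gradient
is differentiable at `x`. -/
def TwiceDifferentiableAt (g : F → ℝ) (x : F) : Prop :=
  (∀ᶠ y in 𝓝 x, DifferentiableAt ℝ g y) ∧ DifferentiableAt ℝ (gradient g) x

/-- The Euclidean Hessian `∇² g(x)`, as a linear operator: the differential of the gradient. -/
def hessian (g : F → ℝ) (x : F) : F →L[ℝ] F := fderiv ℝ (gradient g) x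

/-- `g` is twice differentiable at all points of `S`, and its Hessian is Lipschitz continuous on `S`
for the operator norm. -/
def HasLipschitzHessianOn (g : F → ℝ) (S : Set F) : Prop :=
  (∀ x ∈ S, TwiceDifferentiableAt g x) ∧ ∃ K : NNReal, LipschitzOnWith K (hessian g) S

end Hilbert

variable {E : Type*} [NormedAddCommGroup E] [InnerProductSpace ℝ E]

/-- `M` is a smooth embedded submanifold of dimension `d` of `E`: around each of its points there is
a diffeomorphism `Φ` between open subsets of `E` which maps `M` onto a piece of a `d`-dimensional
linear subspace `V` (a slice chart). -/
def IsSmoothSubmanifold (d : ℕ) (M : Set E) : Prop :=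
  ∀ x ∈ M, ∃ (Φ : OpenPartialHomeomorph E E) (V : Submodule ℝ E),
    x ∈ Φ.source ∧ Module.finrank ℝ V = d ∧
    ContDiffOn ℝ ∞ Φ Φ.source ∧ ContDiffOn ℝ ∞ Φ.symm Φ.target ∧
    ∀ y ∈ Φ.source, y ∈ M ↔ Φ y ∈ V

/-- The tangent space to `M` at `x`, as a linear subspace of `E`: the velocities at `x` of the
smooth curves on `M` that pass through `x`. (For a submanifold these velocities already form a
linear subspace, so that the span adds nothing.) -/
def tangentSpace (M : Set E) (x : E) : Submodule ℝ E :=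
  Submodule.span ℝ {v | ∃ (c : ℝ → E) (ε : ℝ), 0 < ε ∧ ContDiffOn ℝ ∞ c (Ioo (-ε) ε) ∧
    MapsTo c (Ioo (-ε) ε) M ∧ c 0 = x ∧ deriv c 0 = v}

/-- The tangent bundle of `M`, as a subset of `E × E`. -/
def tangentBundle (M : Set E) : Set (E × E) := {p | p.1 ∈ M ∧ p.2 ∈ tangentSpace M p.1}

/-- `R` restricts to a retraction on `M`: `R x η` stands for `Retr_x(η)`, and only the values at
`x ∈ M`, `η ∈ T_x M` matter. Smoothness on the submanifold `TM` of `E × E` is smoothness within this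
set. -/
structure IsRetraction (M : Set E) (R : E → E → E) : Prop where
  mapsTo : ∀ x ∈ M, ∀ η ∈ tangentSpace M x, R x η ∈ M
  smooth : ContDiffOn ℝ ∞ (fun p : E × E => R p.1 p.2) (tangentBundle M)
  map_zero : ∀ x ∈ M, R x 0 = x
  hasFDerivAt_zero : ∀ x ∈ M,
    HasFDerivAt (fun η : tangentSpace M x => R x (η : E)) (tangentSpace M x).subtypeL 0

/-- The pullback `f ∘ Retr_x : T_x M → ℝ`. -/
def pullback (M : Set E) (R : E → E → E) (f : E → ℝ) (x : E) : tangentSpace M x → ℝ :=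
  fun η => f (R x (η : E))

variable [FiniteDimensional ℝ E]

/-- The covariant derivative `D/dt Z` of a tangent vector field `Z` along a curve `c` on `M`, for the
Riemannian metric that `M` inherits from `E`: the tangential part of the derivative in `E`. -/
def covariantDeriv (M : Set E) (c Z : ℝ → E) (t : ℝ) : tangentSpace M (c t) :=
  (tangentSpace M (c t)).orthogonalProjectionOnto (deriv Z t)

/-- The acceleration `D²/dt² c` of a curve `c` on `M`: the covariant derivative of its velocity. -/
def acceleration (M : Set E) (c : ℝ → E) (t : ℝ) : tangentSpace M (c t) :=
  covariantDeriv M c (deriv c) t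

/-- A second-order retraction: the curves `t ↦ Retr_x(tη)` have zero acceleration at `t = 0`. -/
structure IsSecondOrderRetraction (M : Set E) (R : E → E → E) : Prop extends IsRetraction M R where
  acceleration_zero : ∀ x ∈ M, ∀ η ∈ tangentSpace M x,
    acceleration M (fun t : ℝ => R x (t • η)) 0 = 0

/-- The Riemannian gradient of `f` at `x`: the unique tangent vector `g` at `x` such that
`D f(x)[η] = ⟪g, η⟫` for all `η ∈ T_x M`. -/
def riemGrad (M : Set E) (f : E → ℝ) (x : E) : tangentSpace M x :=
  (InnerProductSpace.toDual ℝ (tangentSpace M x)).symm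
    ((fderiv ℝ f x).comp (tangentSpace M x).subtypeL)

/-- The Riemannian Hessian of `f` at `x`: the tangential part of the differential along `M` of the
vector field `grad f`. (The values of `fderivWithin` in directions tangent to `M` do not depend on
choices.) -/
def riemHess (M : Set E) (f : E → ℝ) (x : E) : tangentSpace M x →L[ℝ] tangentSpace M x :=
  (tangentSpace M x).orthogonalProjectionOnto.comp
    ((fderivWithin ℝ (fun y => (riemGrad M f y : E)) M x).comp (tangentSpace M x).subtypeL)

end RiemSub

end

open RiemSub

/-! Write `ρ` for the retraction at `x`, restricted to the tangent space, and `P_y` for the tangent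
projector at `y`.

Hessians: the chain rule gives `⟨ξ, ∇²(f ∘ ρ)(0) η⟩ = ⟨∇f(x), D²ρ(0)[η, ξ]⟩ + ⟨ξ, ∇²f(x) η⟩`.
Differentiating `grad f = P ∇f` along `M` gives the same formula for the Riemannian Hessian, with
`P'(η) ξ` in place of `D²ρ(0)[η, ξ]`, because `P'(η)` is self-adjoint. The two agree: `P_{ρ(tη)}
Dρ(tη) ξ = Dρ(tη) ξ`, and differentiating at `t = 0` yields `P'(η) ξ + P_x D²ρ(0)[η, ξ] = D²ρ(0)[η,
ξ]`, where the projected term vanishes for a second-order retraction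
(`fderivWithin_starProjection_apply`).

Estimate: the unit ball bundle is compact, so the rays `t ↦ ρ(tη)` with `‖η‖ ≤ 1` have uniformly
bounded derivatives and `ρ(η) = x + η + w/2 + O(‖η‖³)`, with `w` the initial second derivative. This
is inserted into the Taylor expansion of `f` on the segment from `x` to `ρ(η)`, which lies in the
convex hull (`abs_sub_taylor_two_le`, `abs_sub_le_of_curve_expansion`). For `‖η‖ ≥ 1`, compactness
of `M` bounds every term by a multiple of `‖η‖³`. -/

noncomputable section

namespace RiemSub

/-! ### Tangent projectors and the unit ball bundle -/

section Projection

open ContinuousLinearMap in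
/-- For an injective continuous linear map `A` out of a finite-dimensional space, `A† ∘ A` is
invertible. -/
theorem exists_equiv_adjoint_comp_self {V E : Type*} [NormedAddCommGroup V]
    [InnerProductSpace ℝ V] [FiniteDimensional ℝ V] [NormedAddCommGroup E] [InnerProductSpace ℝ E]
    [CompleteSpace E] (A : V →L[ℝ] E) (hA : Function.Injective A) :
    ∃ e : V ≃L[ℝ] V, (e : V →L[ℝ] V) = (adjoint A).comp A := by
  have hinj : Function.Injective ((adjoint A).comp A : V →L[ℝ] V).toLinearMap := by
    rw [← LinearMap.ker_eq_bot, LinearMap.ker_eq_bot']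
    intro v hv
    have hv' : (adjoint A) (A v) = 0 := hv
    have h : inner ℝ (A v) (A v) = 0 := by
      rw [← adjoint_inner_left, hv', inner_zero_left]
    exact hA (by rw [inner_self_eq_zero.1 h, map_zero])
  refine ⟨(LinearEquiv.ofInjectiveEndo _ hinj).toContinuousLinearEquiv, ?_⟩
  ext v
  rfl

open ContinuousLinearMap in
/-- The orthogonal projection onto the range of an injective `A` is `A (A† A)⁻¹ A†`. -/
theorem starProjection_range {V E : Type*} [NormedAddCommGroup V]
    [InnerProductSpace ℝ V] [FiniteDimensional ℝ V] [NormedAddCommGroup E] [InnerProductSpace ℝ E]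
    [CompleteSpace E] (A : V →L[ℝ] E) (hA : Function.Injective A) (T : Submodule ℝ E)
    [T.HasOrthogonalProjection] (hT : T = LinearMap.range A.toLinearMap) :
    T.starProjection =
      A.comp ((ContinuousLinearMap.inverse ((adjoint A).comp A)).comp (adjoint A)) := by
  obtain ⟨e, he⟩ := exists_equiv_adjoint_comp_self A hA
  rw [← he, inverse_equiv]
  ext u
  refine Submodule.eq_starProjection_of_mem_of_inner_eq_zero ?_ ?_
  · rw [hT]
    exact ⟨_, rfl⟩
  · intro w hw
    rw [hT] at hw
    obtain ⟨v, rfl⟩ := hw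
    have h1 : adjoint A (A (e.symm (adjoint A u))) = adjoint A u := by
      have := congrArg (fun B : V →L[ℝ] V => B (e.symm (adjoint A u))) he
      simpa using this.symm
    change inner ℝ (u - A (e.symm (adjoint A u))) (A v) = 0
    rw [← adjoint_inner_left, map_sub, h1, sub_self, inner_zero_left]

open ContinuousLinearMap in
/-- If `A y` depends differentiably on `y` and `A x` is injective, then so does
`A (A† A)⁻¹ A†` at `x`. -/
theorem differentiableAt_adjoint_projection {G V E : Type*} [NormedAddCommGroup G]
    [NormedSpace ℝ G] [NormedAddCommGroup V] [InnerProductSpace ℝ V] [FiniteDimensional ℝ V]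
    [NormedAddCommGroup E] [InnerProductSpace ℝ E] [CompleteSpace E] (A : G → V →L[ℝ] E) (x : G)
    (hA : Function.Injective (A x)) (hd : DifferentiableAt ℝ A x) :
    DifferentiableAt ℝ (fun y => (A y).comp
      ((ContinuousLinearMap.inverse ((adjoint (A y)).comp (A y))).comp (adjoint (A y)))) x := by
  obtain ⟨e, he⟩ := exists_equiv_adjoint_comp_self (A x) hA
  have hadj : DifferentiableAt ℝ (fun y => adjoint (A y)) x :=
    ((adjoint : (V →L[ℝ] E) ≃ₗᵢ⋆[ℝ] (E →L[ℝ] V)).toContinuousLinearEquiv.toContinuousLinearMap :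
      (V →L[ℝ] E) →L[ℝ] (E →L[ℝ] V)).differentiableAt.comp x hd
  have hinv : DifferentiableAt ℝ (ContinuousLinearMap.inverse : (V →L[ℝ] V) → (V →L[ℝ] V))
      ((adjoint (A x)).comp (A x)) := by
    rw [← he]
    exact (contDiffAt_map_inverse (n := 1) e).differentiableAt (by simp)
  exact hd.clm_comp (((hinv.comp x (hadj.clm_comp hd))).clm_comp hadj)

variable {E : Type*} [NormedAddCommGroup E] [InnerProductSpace ℝ E]

theorem deriv_mem_tangentSpace {M : Set E} {c : ℝ → E} (hc : ContDiff ℝ ∞ c)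
    (hcM : ∀ t, c t ∈ M) : deriv c 0 ∈ tangentSpace M (c 0) :=
  Submodule.subset_span ⟨c, 1, one_pos, hc.contDiffOn, fun t _ => hcM t, rfl, rfl⟩

/-- In a slice chart `Φ`, the tangent space is the image of the model subspace under the derivative
of `Φ⁻¹`. -/
theorem tangentSpace_eq_map [FiniteDimensional ℝ E] {M : Set E} {Φ : OpenPartialHomeomorph E E}
    {V : Submodule ℝ E} (h1 : ContDiffOn ℝ ∞ Φ Φ.source) (h2 : ContDiffOn ℝ ∞ Φ.symm Φ.target)
    (hV : ∀ y ∈ Φ.source, y ∈ M ↔ Φ y ∈ V) {y : E} (hy : y ∈ Φ.source) (hyM : y ∈ M) :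
    tangentSpace M y = V.map (fderiv ℝ Φ.symm (Φ y)).toLinearMap := by
  have hΦ : DifferentiableAt ℝ Φ y :=
    (h1.contDiffAt (Φ.open_source.mem_nhds hy)).differentiableAt (by simp)
  have hΨc : ContDiffAt ℝ ∞ Φ.symm (Φ y) :=
    h2.contDiffAt (Φ.open_target.mem_nhds (Φ.map_source hy))
  have hΨ : DifferentiableAt ℝ Φ.symm (Φ y) := hΨc.differentiableAt (by simp)
  have hleft : ∀ v, fderiv ℝ Φ.symm (Φ y) (fderiv ℝ Φ y v) = v := by
    have h : HasFDerivAt (Φ.symm ∘ Φ) ((fderiv ℝ Φ.symm (Φ y)).comp (fderiv ℝ Φ y)) y :=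
      hΨ.hasFDerivAt.comp y hΦ.hasFDerivAt
    have h' : HasFDerivAt (Φ.symm ∘ Φ) (ContinuousLinearMap.id ℝ E) y :=
      (hasFDerivAt_id y).congr_of_eventuallyEq
        ((Φ.open_source.mem_nhds hy |> fun h => Filter.mem_of_superset h
          fun z hz => Φ.left_inv hz))
    intro v
    exact congrArg (fun B : E →L[ℝ] E => B v) (h.unique h')
  apply le_antisymm
  · refine Submodule.span_le.2 ?_
    rintro v ⟨c, ε, hε, hc, hcM, rfl, rfl⟩
    have h0 : (0 : ℝ) ∈ Ioo (-ε) ε := ⟨by linarith, hε⟩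
    have hcd : DifferentiableAt ℝ c 0 :=
      (hc.contDiffAt (isOpen_Ioo.mem_nhds h0)).differentiableAt (by simp)
    refine ⟨fderiv ℝ Φ (c 0) (deriv c 0), ?_, hleft _⟩
    have hd : HasDerivAt (Φ ∘ c) (fderiv ℝ Φ (c 0) (deriv c 0)) 0 :=
      hΦ.hasFDerivAt.comp_hasDerivAt 0 hcd.hasDerivAt
    have hclosed : IsClosed (V : Set E) := V.closed_of_finiteDimensional
    have hev : ∀ᶠ t in 𝓝 (0 : ℝ), Φ (c t) ∈ V := by
      filter_upwards [isOpen_Ioo.mem_nhds h0,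
        hcd.continuousAt.preimage_mem_nhds (Φ.open_source.mem_nhds hy)] with t ht1 ht2
      exact (hV _ ht2).1 (hcM ht1)
    -- The difference quotients of `Φ ∘ c` at `0` lie in the closed subspace `V`, hence so does
    -- their limit.
    refine hclosed.mem_of_tendsto hd.tendsto_slope ?_
    filter_upwards [hev.filter_mono nhdsWithin_le_nhds] with t ht
    rw [slope_def_module]
    exact V.smul_mem _ (V.sub_mem ht ((hV _ hy).1 hyM))
  · rintro _ ⟨w, hw, rfl⟩
    have hlin : ContDiff ℝ ∞ (fun t : ℝ => Φ y + t • w) := by fun_prop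
    have hmem : ∀ᶠ t in 𝓝 (0 : ℝ), Φ y + t • w ∈ Φ.target := by
      have : ContinuousAt (fun t : ℝ => Φ y + t • w) 0 := hlin.continuous.continuousAt
      exact this.preimage_mem_nhds (Φ.open_target.mem_nhds (by simpa using Φ.map_source hy))
    obtain ⟨ε, hε, hball⟩ := Metric.eventually_nhds_iff_ball.1 hmem
    have hIoo : ∀ t ∈ Ioo (-ε) ε, Φ y + t • w ∈ Φ.target := fun t ht =>
      hball t (by rw [Real.ball_eq_Ioo]; simpa using ht)
    refine Submodule.subset_span ⟨fun t => Φ.symm (Φ y + t • w), ε, hε,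
      h2.comp hlin.contDiffOn hIoo, fun t ht => ?_, ?_, ?_⟩
    · refine (hV _ (Φ.map_target (hIoo t ht))).2 ?_
      rw [Φ.right_inv (hIoo t ht)]
      exact V.add_mem ((hV _ hy).1 hyM) (V.smul_mem _ hw)
    · simp [Φ.left_inv hy]
    · have hl : HasDerivAt (fun t : ℝ => Φ y + t • w) w 0 := by
        simpa using ((hasDerivAt_id (0 : ℝ)).smul_const w).const_add (Φ y)
      have hΨ' : HasFDerivAt Φ.symm (fderiv ℝ Φ.symm (Φ y)) (Φ y + (0 : ℝ) • w) := by
        simpa using hΨ.hasFDerivAt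
      exact (hΨ'.comp_hasDerivAt 0 hl).deriv

/-- The orthogonal projector onto the tangent space depends differentiably on the base point. -/
theorem differentiableOn_starProjection_tangentSpace [FiniteDimensional ℝ E] {d : ℕ} {M : Set E}
    (hM : IsSmoothSubmanifold d M) :
    DifferentiableOn ℝ (fun y => (tangentSpace M y).starProjection) M := by
  intro x hx
  obtain ⟨Φ, V, hxs, -, h1, h2, hV⟩ := hM x hx
  have hΦ : ∀ y ∈ Φ.source, DifferentiableAt ℝ Φ y := fun y hy =>
    (h1.contDiffAt (Φ.open_source.mem_nhds hy)).differentiableAt (by simp)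
  have hΨc : ∀ y ∈ Φ.source, ContDiffAt ℝ ∞ Φ.symm (Φ y) := fun y hy =>
    h2.contDiffAt (Φ.open_target.mem_nhds (Φ.map_source hy))
  have hinj : ∀ y ∈ Φ.source, Function.Injective (fderiv ℝ Φ.symm (Φ y)) := by
    intro y hy
    have hd : DifferentiableAt ℝ Φ (Φ.symm (Φ y)) := by
      rw [Φ.left_inv hy]; exact hΦ y hy
    have h : HasFDerivAt (Φ ∘ Φ.symm) ((fderiv ℝ Φ (Φ.symm (Φ y))).comp
        (fderiv ℝ Φ.symm (Φ y))) (Φ y) :=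
      hd.hasFDerivAt.comp (Φ y) ((hΨc y hy).differentiableAt (by simp)).hasFDerivAt
    have h' : HasFDerivAt (Φ ∘ Φ.symm) (ContinuousLinearMap.id ℝ E) (Φ y) :=
      (hasFDerivAt_id (Φ y)).congr_of_eventuallyEq
        (Filter.mem_of_superset (Φ.open_target.mem_nhds (Φ.map_source hy))
          fun z hz => Φ.right_inv hz)
    refine Function.LeftInverse.injective (g := fderiv ℝ Φ (Φ.symm (Φ y))) fun v => ?_
    exact congrArg (fun B : E →L[ℝ] E => B v) (h.unique h')
  -- On `M` near `x`, `A y` is injective with range the tangent space, so the projector is `A (A†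
  -- A)⁻¹ A†` there.
  set A : E → V →L[ℝ] E := fun y => (fderiv ℝ Φ.symm (Φ y)).comp V.subtypeL with hAdef
  have hAinj : ∀ y ∈ Φ.source, Function.Injective (A y) := fun y hy =>
    (hinj y hy).comp Subtype.val_injective
  have hAd : DifferentiableAt ℝ A x := by
    have h : DifferentiableAt ℝ (fderiv ℝ Φ.symm) (Φ x) :=
      ((hΨc x hxs).fderiv_right (m := 1) (WithTop.coe_le_coe.2 le_top)).differentiableAt (by simp)
    exact (h.comp x (hΦ x hxs)).clm_comp (differentiableAt_const _)
  refine ((differentiableAt_adjoint_projection A x (hAinj x hxs) hAd).differentiableWithinAt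
    (s := M)).congr_of_eventuallyEq_of_mem ?_ hx
  filter_upwards [self_mem_nhdsWithin, nhdsWithin_le_nhds (Φ.open_source.mem_nhds hxs)] with y hyM hy
  refine starProjection_range (A y) (hAinj y hy) _ ?_
  rw [tangentSpace_eq_map h1 h2 hV hy hyM]
  ext v
  simp [A]

/-- The unit ball bundle of the tangent bundle of a compact submanifold is compact. -/
theorem isCompact_tangentBundle_unitBall [FiniteDimensional ℝ E] {d : ℕ} {M : Set E}
    (hM : IsSmoothSubmanifold d M) (hMc : IsCompact M) :
    IsCompact {p : E × E | p ∈ tangentBundle M ∧ ‖p.2‖ ≤ 1} := by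
  have hK : IsCompact (M ×ˢ Metric.closedBall (0 : E) 1) :=
    hMc.prod (isCompact_closedBall _ _)
  -- Tangency of `v` at `y` is the equation `P_y v - v = 0`, a closed condition because `P` is
  -- continuous on `M`.
  have hP : ContinuousOn (fun p : E × E => (tangentSpace M p.1).starProjection p.2 - p.2)
      (M ×ˢ Metric.closedBall (0 : E) 1) := by
    refine ContinuousOn.sub (ContinuousOn.clm_apply ?_ continuousOn_snd) continuousOn_snd
    exact (differentiableOn_starProjection_tangentSpace hM).continuousOn.comp continuousOn_fst
      fun p hp => hp.1
  have := hP.preimage_isClosed_of_isClosed hK.isClosed (isClosed_singleton (x := (0 : E)))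
  convert hK.of_isClosed_subset this inter_subset_left using 1
  ext p
  simp only [tangentBundle, mem_ofPred_eq, mem_inter_iff, mem_prod, mem_closedBall_zero_iff,
    mem_preimage, mem_singleton_iff, sub_eq_zero, Submodule.starProjection_eq_self_iff]
  tauto

end Projection

/-! ### Uniform derivative bounds along rays of a retraction -/

section Retraction

/-- Restricted to a line contained in `S`, a `C^n` function on `S` has derivatives up to order `n`
that are locally bounded, uniformly over all such lines. -/
theorem exists_nhdsWithin_iteratedDeriv_line_le {G H : Type*} [NormedAddCommGroup G]
    [NormedSpace ℝ G] [NormedAddCommGroup H] [NormedSpace ℝ H] {F : G → H} {S : Set G} {n : ℕ}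
    (hF : ContDiffOn ℝ n F S) {p : G} (hp : p ∈ S) :
    ∃ t ∈ 𝓝[S] p, ∃ C : ℝ, ∀ a v : G, (∀ s : ℝ, a + s • v ∈ S) → ∀ s : ℝ, a + s • v ∈ t →
      ∀ m ≤ n, ‖iteratedDeriv m (fun r : ℝ => F (a + r • v)) s‖ ≤ C * ‖v‖ ^ m := by
  obtain ⟨u, hu, P, hP⟩ := (hF p hp) n le_rfl
  rw [insert_eq_of_mem hp] at hu
  obtain ⟨O, hO, hpO, hOu⟩ := mem_nhdsWithin.1 hu
  have hPO : HasFTaylorSeriesUpToOn n F P (O ∩ S) := hP.mono hOu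
  -- Derivatives within `S` need not be unique, but on a line inside `S` any Taylor series
  -- determines the ordinary derivatives, as its values on the diagonal `(v, ..., v)`.
  have key : ∀ a v : G, (∀ s : ℝ, a + s • v ∈ S) → ∀ m ≤ n, ∀ s : ℝ, a + s • v ∈ O →
      iteratedDeriv m (fun r : ℝ => F (a + r • v)) s = P (a + s • v) m (fun _ => v) := by
    intro a v hav m
    induction m with
    | zero =>
      intro _ s hs
      rw [iteratedDeriv_zero, ← hPO.zero_eq _ ⟨hs, hav s⟩, ContinuousMultilinearMap.curry0]
      congr 1
      exact Subsingleton.elim _ _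
    | succ m ih =>
      intro hm s hs
      have hline : HasDerivAt (fun r : ℝ => a + r • v) v s := by
        simpa using ((hasDerivAt_id s).smul_const v).const_add a
      have hpre : ∀ᶠ r in 𝓝 s, a + r • v ∈ O :=
        hline.continuousAt.preimage_mem_nhds (hO.mem_nhds hs)
      have heq : iteratedDeriv m (fun r : ℝ => F (a + r • v)) =ᶠ[𝓝 s]
          fun r => P (a + r • v) m (fun _ => v) := by
        filter_upwards [hpre] with r hr
        exact ih (by omega) r hr
      rw [iteratedDeriv_succ, heq.deriv_eq]
      have h1 := hPO.fderivWithin m (by exact_mod_cast hm) _ ⟨hs, hav s⟩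
      have h2 : HasFDerivWithinAt (fun y => P y m (fun _ => v))
          ((ContinuousMultilinearMap.apply ℝ (fun _ : Fin m => G) H (fun _ => v)).comp
            (P (a + s • v) (m + 1)).curryLeft) (O ∩ S) (a + s • v) :=
        (ContinuousMultilinearMap.apply ℝ (fun _ : Fin m => G) H
          (fun _ => v)).hasFDerivAt.comp_hasFDerivWithinAt _ h1
      have h3 := h2.comp_hasDerivAt_of_eq s hline
        (hpre.mono fun r hr => ⟨hr, hav r⟩) rfl
      have h4 := h3.deriv
      refine h4.trans ?_
      change P (a + s • v) (m + 1) (Fin.cons v fun _ => v) = _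
      congr 1
      ext i
      refine Fin.cases rfl (fun _ => rfl) i
  have hbd : ∀ m ∈ Finset.range (n + 1), ∀ᶠ q in 𝓝[S] p, ‖P q m‖ < ‖P p m‖ + 1 := by
    intro m hm
    have hc : ContinuousWithinAt (fun q => P q m) (O ∩ S) p :=
      hPO.cont m (by exact_mod_cast Nat.lt_succ_iff.1 (Finset.mem_range.1 hm)) p ⟨hpO, hp⟩
    have := hc.norm.eventually_lt_const (lt_add_one ‖P p m‖)
    rwa [inter_comm, nhdsWithin_inter_of_mem' (nhdsWithin_le_nhds (hO.mem_nhds hpO))] at this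
  refine ⟨_, inter_mem (nhdsWithin_le_nhds (hO.mem_nhds hpO))
    ((Finset.eventually_all _).2 hbd), ∑ m ∈ Finset.range (n + 1), (‖P p m‖ + 1), ?_⟩
  rintro a v hav s ⟨hsO, hs⟩ m hm
  have hmr : m ∈ Finset.range (n + 1) := Finset.mem_range.2 (by omega)
  rw [key a v hav m hm s hsO]
  refine ((P (a + s • v) m).le_opNorm _).trans ?_
  rw [Finset.prod_const, Finset.card_univ, Fintype.card_fin]
  gcongr
  refine (hs m hmr).le.trans ?_
  exact Finset.single_le_sum (f := fun m => ‖P p m‖ + 1) (fun i _ => by positivity) hmr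

/-- Restricted to lines contained in `S`, a `C^n` function on `S` has derivatives up to order `n`
that are bounded on a compact subset of `S`, uniformly over all such lines. -/
theorem exists_iteratedDeriv_line_le {G H : Type*} [NormedAddCommGroup G]
    [NormedSpace ℝ G] [NormedAddCommGroup H] [NormedSpace ℝ H] {F : G → H} {S K : Set G} {n : ℕ}
    (hF : ContDiffOn ℝ n F S) (hK : IsCompact K) (hKS : K ⊆ S) :
    ∃ C : ℝ, ∀ a v : G, (∀ s : ℝ, a + s • v ∈ S) → ∀ s : ℝ, a + s • v ∈ K →
      ∀ m ≤ n, ‖iteratedDeriv m (fun r : ℝ => F (a + r • v)) s‖ ≤ C * ‖v‖ ^ m := by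
  refine hK.induction_on (p := fun t => ∃ C : ℝ, ∀ a v : G, (∀ s : ℝ, a + s • v ∈ S) → ∀ s : ℝ,
    a + s • v ∈ t → ∀ m ≤ n, ‖iteratedDeriv m (fun r : ℝ => F (a + r • v)) s‖ ≤ C * ‖v‖ ^ m)
    ⟨0, fun _ _ _ _ h => h.elim⟩ ?_ ?_ ?_
  · rintro s t hst ⟨C, hC⟩
    exact ⟨C, fun a v hav r hr => hC a v hav r (hst hr)⟩
  · rintro s t ⟨C, hC⟩ ⟨D, hD⟩
    refine ⟨max C D, fun a v hav r hr m hm => ?_⟩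
    rcases hr with hr | hr
    · exact (hC a v hav r hr m hm).trans (by gcongr; exact le_max_left _ _)
    · exact (hD a v hav r hr m hm).trans (by gcongr; exact le_max_right _ _)
  · intro p hp
    obtain ⟨t, ht, C, hC⟩ := exists_nhdsWithin_iteratedDeriv_line_le hF (hKS hp)
    exact ⟨t, nhdsWithin_mono p hKS ht, C, hC⟩

/-- The second-order Taylor expansion of a smooth curve on `[0, 1]`. -/
theorem norm_sub_taylor_two_le {H : Type*} [NormedAddCommGroup H] [NormedSpace ℝ H] {c : ℝ → H}
    (hc : ContDiff ℝ ∞ c) {B : ℝ} (hB : ∀ t ∈ Icc (0 : ℝ) 1, ‖iteratedDeriv 3 c t‖ ≤ B) :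
    ‖c 1 - (c 0 + deriv c 0 + (1 / 2 : ℝ) • iteratedDeriv 2 c 0)‖ ≤ B := by
  have hu : UniqueDiffOn ℝ (Icc (0 : ℝ) 1) := uniqueDiffOn_Icc one_pos
  have hi : ∀ (m : ℕ), ∀ t ∈ Icc (0 : ℝ) 1,
      iteratedDerivWithin m c (Icc 0 1) t = iteratedDeriv m c t := fun m t ht =>
    iteratedDerivWithin_eq_iteratedDeriv hu
      (hc.contDiffAt.of_le (WithTop.coe_le_coe.2 le_top)) ht
  have h0 : (0 : ℝ) ∈ Icc (0 : ℝ) 1 := by simp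
  -- The remainder bound is `B / 2!`; the factor `1/2` is given away at the end.
  have h := taylor_mean_remainder_bound (f := c) (n := 2) (C := B) (x := 1) zero_le_one
    ((hc.of_le (WithTop.coe_le_coe.2 le_top)).contDiffOn) (by simp)
    (fun t ht => by rw [hi _ t ht]; exact hB t ht)
  have hB0 : 0 ≤ B := (norm_nonneg _).trans (hB 0 h0)
  rw [taylorWithinEval_succ, taylorWithinEval_succ, taylor_within_zero_eval, hi _ 0 h0,
    hi _ 0 h0] at h
  norm_num [Nat.factorial, iteratedDeriv_one] at h
  norm_num
  linarith

theorem hasDerivAt_comp_smul {G H : Type*} [NormedAddCommGroup G] [NormedSpace ℝ G]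
    [NormedAddCommGroup H] [NormedSpace ℝ H] {g : G → H} {g' : G →L[ℝ] H}
    (hg : HasFDerivAt g g' 0) (v : G) : HasDerivAt (fun t : ℝ => g (t • v)) (g' v) 0 := by
  have hd : HasDerivAt (fun t : ℝ => t • v) v 0 := by
    simpa using (hasDerivAt_id (0 : ℝ)).smul_const v
  rw [← zero_smul ℝ v] at hg
  exact hg.comp_hasDerivAt 0 hd

theorem iteratedDeriv_two_comp_smul {G H : Type*} [NormedAddCommGroup G] [NormedSpace ℝ G]
    [NormedAddCommGroup H] [NormedSpace ℝ H] {g : G → H} (hg : Differentiable ℝ g)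
    (hg' : DifferentiableAt ℝ (fderiv ℝ g) 0) (v : G) :
    iteratedDeriv 2 (fun t : ℝ => g (t • v)) 0 = fderiv ℝ (fderiv ℝ g) 0 v v := by
  have hd : ∀ t : ℝ, HasDerivAt (fun t : ℝ => t • v) v t := fun t => by
    simpa using (hasDerivAt_id t).smul_const v
  have h1 : deriv (fun t : ℝ => g (t • v)) = fun t => fderiv ℝ g (t • v) v :=
    funext fun t => ((hg (t • v)).hasFDerivAt.comp_hasDerivAt t (hd t)).deriv
  rw [iteratedDeriv_succ, iteratedDeriv_one, h1]
  have h2 : HasDerivAt (fun t : ℝ => fderiv ℝ g (t • v)) (fderiv ℝ (fderiv ℝ g) 0 v) 0 :=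
    hasDerivAt_comp_smul hg'.hasFDerivAt v
  have h3 : HasDerivAt (fun t : ℝ => fderiv ℝ g (t • v) v) (fderiv ℝ (fderiv ℝ g) 0 v v) 0 :=
    ((ContinuousLinearMap.apply ℝ H v).hasFDerivAt.comp_hasDerivAt 0 h2)
  exact h3.deriv

variable {E : Type*} [NormedAddCommGroup E] [InnerProductSpace ℝ E]

namespace IsRetraction

variable {M : Set E} {R : E → E → E} {x : E}

/-- A fibre maps into the tangent bundle by `η ↦ (x, η)`, so smoothness within the bundle becomes
smoothness on a whole vector space. -/
theorem contDiff (hR : IsRetraction M R) (hx : x ∈ M) :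
    ContDiff ℝ ∞ (fun η : tangentSpace M x => R x (η : E)) :=
  hR.smooth.comp_contDiff (f := fun η : tangentSpace M x => (x, (η : E)))
    (contDiff_const.prodMk (tangentSpace M x).subtypeL.contDiff) fun η => ⟨hx, η.2⟩

theorem contDiff_ray (hR : IsRetraction M R) (hx : x ∈ M) (η : tangentSpace M x) :
    ContDiff ℝ ∞ (fun t : ℝ => R x (t • (η : E))) :=
  (hR.contDiff hx).comp (contDiff_id.smul contDiff_const : ContDiff ℝ ∞ fun t : ℝ => t • η)

/-- The retraction sends the line `η + t ξ` to a smooth curve on `M`, whose velocity at `0` is this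
vector. -/
theorem fderiv_mem_tangentSpace (hR : IsRetraction M R) (hx : x ∈ M) (η ξ : tangentSpace M x) :
    fderiv ℝ (fun η : tangentSpace M x => R x (η : E)) η ξ ∈ tangentSpace M (R x (η : E)) := by
  have hline : ContDiff ℝ ∞ (fun t : ℝ => η + t • ξ) := by fun_prop
  have hd : HasDerivAt (fun t : ℝ => η + t • ξ) ξ 0 := by
    simpa using ((hasDerivAt_id (0 : ℝ)).smul_const ξ).const_add η
  have h := deriv_mem_tangentSpace (M := M) ((hR.contDiff hx).comp hline)
    fun t => hR.mapsTo x hx _ (η + t • ξ).2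
  have h' : HasFDerivAt (fun η : tangentSpace M x => R x (η : E))
      (fderiv ℝ (fun η : tangentSpace M x => R x (η : E)) η) (η + (0 : ℝ) • ξ) := by
    simpa using ((hR.contDiff hx).differentiable (by simp) η).hasFDerivAt
  rw [(h'.comp_hasDerivAt 0 hd).deriv] at h
  simpa using h

theorem fderiv_zero (hR : IsRetraction M R) (hx : x ∈ M) :
    fderiv ℝ (fun η : tangentSpace M x => R x (η : E)) 0 = (tangentSpace M x).subtypeL :=
  (hR.hasFDerivAt_zero x hx).fderiv

theorem differentiableAt_fderiv (hR : IsRetraction M R) (hx : x ∈ M) (η : tangentSpace M x) :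
    DifferentiableAt ℝ (fderiv ℝ (fun η : tangentSpace M x => R x (η : E))) η :=
  ((hR.contDiff hx).fderiv_right (m := 1) (WithTop.coe_le_coe.2 le_top)).differentiable (by simp) η

theorem iteratedDeriv_two_ray (hR : IsRetraction M R) (hx : x ∈ M) (η : tangentSpace M x) :
    iteratedDeriv 2 (fun t : ℝ => R x (t • (η : E))) 0 =
      fderiv ℝ (fderiv ℝ (fun η : tangentSpace M x => R x (η : E))) 0 η η :=
  iteratedDeriv_two_comp_smul ((hR.contDiff hx).differentiable (by simp))
    (hR.differentiableAt_fderiv hx 0) η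

theorem fderiv_fderiv_comm (hR : IsRetraction M R) (hx : x ∈ M) (η ξ : tangentSpace M x) :
    fderiv ℝ (fderiv ℝ (fun η : tangentSpace M x => R x (η : E))) 0 η ξ =
      fderiv ℝ (fderiv ℝ (fun η : tangentSpace M x => R x (η : E))) 0 ξ η :=
  (hR.contDiff hx).contDiffAt.isSymmSndFDerivAt
    (by rw [minSmoothness_of_isRCLikeNormedField]; exact WithTop.coe_le_coe.2 le_top) η ξ

/-- Along a compact submanifold, the derivatives of the curves `t ↦ Retr_x(tη)` on the unit ball
bundle are bounded uniformly in `x`. -/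
theorem exists_iteratedDeriv_ray_le [FiniteDimensional ℝ E] {d : ℕ} (hR : IsRetraction M R)
    (hM : IsSmoothSubmanifold d M) (hMc : IsCompact M) (n : ℕ) :
    ∃ C : ℝ, 0 ≤ C ∧ ∀ x ∈ M, ∀ η : tangentSpace M x, ∀ t : ℝ, ‖t • η‖ ≤ 1 → ∀ m ≤ n,
      ‖iteratedDeriv m (fun t : ℝ => R x (t • (η : E))) t‖ ≤ C * ‖η‖ ^ m := by
  obtain ⟨C, hC⟩ := exists_iteratedDeriv_line_le (n := n)
    (hR.smooth.of_le (WithTop.coe_le_coe.2 le_top)) (isCompact_tangentBundle_unitBall hM hMc)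
    fun p hp => hp.1
  refine ⟨max C 0, le_max_right _ _, fun x hx η t ht m hm => ?_⟩
  -- A ray moves inside one fibre, so as a line in `E × E` it never leaves the bundle.
  have h := hC (x, 0) (0, (η : E)) (fun s => ?_) t ⟨?_, ?_⟩ m hm
  · simp only [Prod.smul_mk, smul_zero, Prod.mk_add_mk, add_zero, zero_add] at h
    refine h.trans ?_
    rw [Prod.norm_mk, norm_zero, max_eq_right (norm_nonneg _), Submodule.coe_norm]
    gcongr
    exact le_max_left _ _
  · exact ⟨by simpa using hx, by simpa using (s • η).2⟩
  · exact ⟨by simpa using hx, by simpa using (t • η).2⟩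
  · simpa [norm_smul] using ht

end IsRetraction

/-- Zero acceleration is the case `η = ξ`; symmetry of the second derivative gives the rest by
polarization. -/
theorem IsSecondOrderRetraction.starProjection_fderiv_fderiv_zero [FiniteDimensional ℝ E]
    {M : Set E} {R : E → E → E} {x : E} (hR : IsSecondOrderRetraction M R) (hx : x ∈ M)
    (η ξ : tangentSpace M x) :
    (tangentSpace M x).starProjection
      (fderiv ℝ (fderiv ℝ (fun η : tangentSpace M x => R x (η : E))) 0 η ξ) = 0 := by
  have hdiag : ∀ ζ : tangentSpace M x, (tangentSpace M x).starProjection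
      (fderiv ℝ (fderiv ℝ (fun η : tangentSpace M x => R x (η : E))) 0 ζ ζ) = 0 := by
    intro ζ
    have h := congrArg Subtype.val (hR.acceleration_zero x hx ζ ζ.2)
    have hcoe : ((tangentSpace M (R x ((0 : ℝ) • (ζ : E)))).starProjection
        (deriv (deriv fun t : ℝ => R x (t • (ζ : E))) 0)) = 0 := h
    rw [zero_smul, hR.map_zero x hx] at hcoe
    rwa [← hR.iteratedDeriv_two_ray hx, iteratedDeriv_succ, iteratedDeriv_one]
  have h := hdiag (η + ξ)
  simp only [map_add, _root_.add_apply, hdiag, zero_add, add_zero] at h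
  rw [hR.fderiv_fderiv_comm hx ξ η, ← two_smul ℝ] at h
  exact (smul_eq_zero.1 h).resolve_left two_ne_zero

end Retraction

/-! ### Taylor expansion and the chain rule for Hessians -/

section Hessian

section Hilbert

variable {F : Type*} [NormedAddCommGroup F] [InnerProductSpace ℝ F] [CompleteSpace F]

theorem TwiceDifferentiableAt.differentiableAt {g : F → ℝ} {x : F}
    (h : TwiceDifferentiableAt g x) : DifferentiableAt ℝ g x :=
  h.1.self_of_nhds

theorem TwiceDifferentiableAt.hasFDerivAt_gradient {g : F → ℝ} {x : F}
    (h : TwiceDifferentiableAt g x) : HasFDerivAt (gradient g) (hessian g x) x :=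
  h.2.hasFDerivAt

theorem inner_gradient_left {g : F → ℝ} (x v : F) :
    inner ℝ (gradient g x) v = fderiv ℝ g x v := by
  rw [gradient, InnerProductSpace.toDual_symm_apply]

/-- The second-order Taylor expansion of a function with Lipschitz Hessian on a convex set. -/
theorem abs_sub_taylor_two_le {g : F → ℝ} {S : Set F} (hS : Convex ℝ S)
    (hg : ∀ x ∈ S, TwiceDifferentiableAt g x) {K : NNReal} (hK : LipschitzOnWith K (hessian g) S)
    {x y : F} (hx : x ∈ S) (hy : y ∈ S) :
    |g y - (g x + inner ℝ (gradient g x) (y - x) +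
      1 / 2 * inner ℝ (y - x) (hessian g x (y - x)))| ≤ K * ‖y - x‖ ^ 3 := by
  obtain ⟨h, hh⟩ : ∃ h, h = y - x := ⟨_, rfl⟩
  rw [← hh]
  have hline : ∀ t : ℝ, HasDerivAt (fun t : ℝ => x + t • h) h t := fun t => by
    simpa using ((hasDerivAt_id t).smul_const h).const_add x
  have hmem : ∀ t ∈ Icc (0 : ℝ) 1, x + t • h ∈ S := fun t ht => by
    rw [hh]
    exact hS.add_smul_sub_mem hx hy ht
  -- The mean value inequality is used twice, for the gradient and then for `g`. The factors that
  -- integration would gain are dropped, leaving `K` instead of `K / 6`.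
  have hgrad : ∀ t ∈ Icc (0 : ℝ) 1,
      ‖gradient g (x + t • h) - t • hessian g x h - gradient g x‖ ≤ K * ‖h‖ ^ 2 := by
    intro t ht
    have hd : ∀ s ∈ Icc (0 : ℝ) 1, HasDerivWithinAt
        (fun s : ℝ => gradient g (x + s • h) - s • hessian g x h)
        (hessian g (x + s • h) h - hessian g x h) (Icc 0 1) s := by
      intro s hs
      have h1 := (hg _ (hmem s hs)).hasFDerivAt_gradient.comp_hasDerivAt s (hline s)
      have h2 : HasDerivAt (fun s : ℝ => s • hessian g x h) (hessian g x h) s := by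
        simpa using (hasDerivAt_id s).smul_const (hessian g x h)
      exact (h1.sub h2).hasDerivWithinAt
    have hb : ∀ s ∈ Ico (0 : ℝ) 1,
        ‖hessian g (x + s • h) h - hessian g x h‖ ≤ K * ‖h‖ ^ 2 := by
      intro s hs
      have h1 := hK.dist_le_mul _ (hmem s ⟨hs.1, hs.2.le⟩) _ hx
      rw [dist_eq_norm, dist_eq_norm, add_sub_cancel_left, norm_smul, Real.norm_of_nonneg hs.1] at h1
      have h2 : (K : ℝ) * (s * ‖h‖) ≤ K * ‖h‖ := by
        gcongr
        exact mul_le_of_le_one_left (norm_nonneg _) hs.2.le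
      calc ‖hessian g (x + s • h) h - hessian g x h‖
          = ‖(hessian g (x + s • h) - hessian g x) h‖ := rfl
        _ ≤ ‖hessian g (x + s • h) - hessian g x‖ * ‖h‖ := ContinuousLinearMap.le_opNorm _ _
        _ ≤ K * ‖h‖ * ‖h‖ := by gcongr; exact h1.trans h2
        _ = K * ‖h‖ ^ 2 := by ring
    have h3 := norm_image_sub_le_of_norm_deriv_le_segment' hd hb t ht
    simp only [zero_smul, add_zero, sub_zero] at h3
    exact h3.trans (mul_le_of_le_one_right (by positivity) ht.2)
  have hd : ∀ t ∈ Icc (0 : ℝ) 1, HasDerivWithinAt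
      (fun t : ℝ => g (x + t • h) - (t * inner ℝ (gradient g x) h +
        t ^ 2 * (1 / 2 * inner ℝ h (hessian g x h))))
      (inner ℝ (gradient g (x + t • h) - t • hessian g x h - gradient g x) h) (Icc 0 1) t := by
    intro t ht
    have h1 := (hg _ (hmem t ht)).differentiableAt.hasFDerivAt.comp_hasDerivAt t (hline t)
    have h2 : HasDerivAt (fun t : ℝ => t * inner ℝ (gradient g x) h +
        t ^ 2 * (1 / 2 * inner ℝ h (hessian g x h))) _ t :=
      ((hasDerivAt_id t).mul_const _).add (((hasDerivAt_id t).pow 2).mul_const _)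
    refine (h1.sub h2).hasDerivWithinAt.congr_deriv ?_
    rw [inner_sub_left, inner_sub_left, inner_gradient_left, real_inner_smul_left,
      real_inner_comm h]
    simp [real_inner_comm h]
    ring
  have hb : ∀ t ∈ Ico (0 : ℝ) 1,
      ‖inner ℝ (gradient g (x + t • h) - t • hessian g x h - gradient g x) h‖ ≤ K * ‖h‖ ^ 3 := by
    intro t ht
    refine (norm_inner_le_norm _ _).trans ?_
    calc _ ≤ K * ‖h‖ ^ 2 * ‖h‖ := by gcongr; exact hgrad t ⟨ht.1, ht.2.le⟩
      _ = K * ‖h‖ ^ 3 := by ring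
  have h4 := norm_image_sub_le_of_norm_deriv_le_segment_01' hd hb
  have hxy : x + (1 : ℝ) • h = y := by simp [hh]
  rw [hxy] at h4
  refine le_trans (le_of_eq ?_) h4
  rw [Real.norm_eq_abs]
  congr 1
  simp
  ring

variable {T : Type*} [NormedAddCommGroup T] [InnerProductSpace ℝ T] [CompleteSpace T]

open ContinuousLinearMap in
/-- The gradient of a composition. -/
theorem gradient_comp {f : F → ℝ} {ρ : T → F} {η : T} (hf : DifferentiableAt ℝ f (ρ η))
    (hρ : DifferentiableAt ℝ ρ η) :
    gradient (fun η => f (ρ η)) η = adjoint (fderiv ℝ ρ η) (gradient f (ρ η)) := by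
  refine ext_inner_right ℝ fun ξ => ?_
  rw [adjoint_inner_left, inner_gradient_left, inner_gradient_left]
  exact congrArg (fun B : T →L[ℝ] ℝ => B ξ) (hf.hasFDerivAt.comp η hρ.hasFDerivAt).fderiv

open ContinuousLinearMap in
theorem TwiceDifferentiableAt.comp {f : F → ℝ} {ρ : T → F} {η : T}
    (hf : TwiceDifferentiableAt f (ρ η)) (hρ : ∀ᶠ ζ in 𝓝 η, DifferentiableAt ℝ ρ ζ)
    (hρ' : DifferentiableAt ℝ (fderiv ℝ ρ) η) :
    TwiceDifferentiableAt (fun ζ => f (ρ ζ)) η := by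
  have hc : ContinuousAt ρ η := hρ.self_of_nhds.continuousAt
  have hev := (hc.eventually hf.1).and hρ
  refine ⟨hev.mono fun ζ hζ => hζ.1.comp ζ hζ.2, ?_⟩
  have heq : gradient (fun ζ => f (ρ ζ)) =ᶠ[𝓝 η]
      fun ζ => adjoint (fderiv ℝ ρ ζ) (gradient f (ρ ζ)) :=
    hev.mono fun ζ hζ => gradient_comp hζ.1 hζ.2
  refine DifferentiableAt.congr_of_eventuallyEq ?_ heq
  have hadj : DifferentiableAt ℝ (fun ζ => adjoint (fderiv ℝ ρ ζ)) η :=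
    ((adjoint : (T →L[ℝ] F) ≃ₗᵢ⋆[ℝ] (F →L[ℝ] T)).toContinuousLinearEquiv.toContinuousLinearMap :
      (T →L[ℝ] F) →L[ℝ] (F →L[ℝ] T)).differentiableAt.comp η hρ'
  exact hadj.clm_apply (hf.2.comp η hρ.self_of_nhds)

/-- The Hessian of a composition. -/
theorem inner_hessian_comp {f : F → ℝ} {ρ : T → F} {η : T}
    (hf : TwiceDifferentiableAt f (ρ η)) (hρ : ∀ᶠ ζ in 𝓝 η, DifferentiableAt ℝ ρ ζ)
    (hρ' : DifferentiableAt ℝ (fderiv ℝ ρ) η) (ξ v : T) :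
    inner ℝ ξ (hessian (fun ζ => f (ρ ζ)) η v) =
      inner ℝ (gradient f (ρ η)) (fderiv ℝ (fderiv ℝ ρ) η v ξ) +
        inner ℝ (fderiv ℝ ρ η ξ) (hessian f (ρ η) (fderiv ℝ ρ η v)) := by
  have hc : ContinuousAt ρ η := hρ.self_of_nhds.continuousAt
  -- Pairing with a fixed `ξ` moves the adjoint onto `ξ`, so only the product rule for an inner
  -- product is needed.
  have heq : (fun ζ => inner ℝ ξ (gradient (fun ζ => f (ρ ζ)) ζ)) =ᶠ[𝓝 η]
      fun ζ => inner ℝ (fderiv ℝ ρ ζ ξ) (gradient f (ρ ζ)) := by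
    filter_upwards [hc.eventually hf.1, hρ] with ζ h1 h2
    rw [gradient_comp h1 h2, ContinuousLinearMap.adjoint_inner_right]
  have h1 : HasFDerivAt (fun ζ => inner ℝ ξ (gradient (fun ζ => f (ρ ζ)) ζ))
      ((innerSL ℝ ξ).comp (hessian (fun ζ => f (ρ ζ)) η)) η :=
    (innerSL ℝ ξ).hasFDerivAt.comp η (hf.comp hρ hρ').hasFDerivAt_gradient
  have h2 : HasFDerivAt (fun ζ => fderiv ℝ ρ ζ ξ)
      ((ContinuousLinearMap.apply ℝ F ξ).comp (fderiv ℝ (fderiv ℝ ρ) η)) η :=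
    (ContinuousLinearMap.apply ℝ F ξ).hasFDerivAt.comp η hρ'.hasFDerivAt
  have h3 : HasFDerivAt (fun ζ => gradient f (ρ ζ))
      ((hessian f (ρ η)).comp (fderiv ℝ ρ η)) η :=
    hf.hasFDerivAt_gradient.comp η hρ.self_of_nhds.hasFDerivAt
  have h4 := h1.unique ((h2.inner ℝ h3).congr_of_eventuallyEq heq)
  have h5 := congrArg (fun B : T →L[ℝ] ℝ => B v) h4
  simp only [ContinuousLinearMap.comp_apply, innerSL_apply_apply, ContinuousLinearMap.prod_apply,
    fderivInnerCLM_apply, ContinuousLinearMap.apply_apply] at h5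
  rw [h5, add_comm, real_inner_comm (gradient f (ρ η))]

end Hilbert

variable {E : Type*} [NormedAddCommGroup E] [InnerProductSpace ℝ E] [FiniteDimensional ℝ E]
  {M : Set E} {R : E → E → E} {f : E → ℝ} {x : E}

/-- This presents `grad f` as a projector applied to `∇f`, ready for the product rule. -/
theorem coe_riemGrad (M : Set E) (f : E → ℝ) (y : E) :
    (riemGrad M f y : E) = (tangentSpace M y).starProjection (gradient f y) := by
  refine (Submodule.eq_starProjection_of_mem_of_inner_eq_zero (riemGrad M f y).2 ?_).symm
  intro w hw
  have h : inner ℝ (riemGrad M f y) (⟨w, hw⟩ : tangentSpace M y) = fderiv ℝ f y w := by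
    rw [riemGrad, InnerProductSpace.toDual_symm_apply]
    rfl
  rw [inner_sub_left, inner_gradient_left, sub_eq_zero, ← h]
  rfl

theorem inner_riemGrad_right (η : tangentSpace M x) :
    inner ℝ η (riemGrad M f x) = inner ℝ (gradient f x) (η : E) := by
  rw [real_inner_comm, riemGrad, InnerProductSpace.toDual_symm_apply, inner_gradient_left]
  rfl

theorem differentiableWithinAt_riemGrad
    (hP : DifferentiableOn ℝ (fun y => (tangentSpace M y).starProjection) M) (hx : x ∈ M)
    (hf : TwiceDifferentiableAt f x) :
    DifferentiableWithinAt ℝ (fun y => (riemGrad M f y : E)) M x := by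
  simp only [coe_riemGrad]
  exact (hP x hx).clm_apply hf.2.differentiableWithinAt

/-! ### Hessian of the pullback versus Riemannian Hessian -/

namespace IsSecondOrderRetraction

theorem hasDerivAt_ray (hR : IsSecondOrderRetraction M R) (hx : x ∈ M) (η : tangentSpace M x) :
    HasDerivAt (fun t : ℝ => R x (t • (η : E))) (η : E) 0 := by
  exact hasDerivAt_comp_smul (hR.hasFDerivAt_zero x hx) η

/-- A map that is differentiable along `M` is differentiable along the curves `t ↦ Retr_x(tη)`. -/
theorem hasDerivAt_comp_ray {H : Type*} [NormedAddCommGroup H] [NormedSpace ℝ H]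
    (hR : IsSecondOrderRetraction M R) (hx : x ∈ M) {Q : E → H} {Q' : E →L[ℝ] H}
    (hQ : HasFDerivWithinAt Q Q' M x) (η : tangentSpace M x) :
    HasDerivAt (fun t : ℝ => Q (R x (t • (η : E)))) (Q' η) 0 :=
  hQ.comp_hasDerivAt_of_eq 0 (hR.hasDerivAt_ray hx η)
    (Eventually.of_forall fun t => hR.mapsTo x hx _ (t • η).2)
    (by rw [zero_smul, hR.map_zero x hx])

/-- The second derivative of a second-order retraction is the derivative of the tangent
projectors. -/
theorem fderivWithin_starProjection_apply (hR : IsSecondOrderRetraction M R) (hx : x ∈ M)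
    {P' : E →L[ℝ] E →L[ℝ] E}
    (hP : HasFDerivWithinAt (fun y => (tangentSpace M y).starProjection) P' M x)
    (η ξ : tangentSpace M x) :
    P' η ξ = fderiv ℝ (fderiv ℝ (fun η : tangentSpace M x => R x (η : E))) 0 η ξ := by
  set ρ : tangentSpace M x → E := fun η => R x (η : E) with hρ
  have h1 : HasDerivAt (fun t : ℝ => fderiv ℝ ρ (t • η)) (fderiv ℝ (fderiv ℝ ρ) 0 η) 0 :=
    hasDerivAt_comp_smul (g := fderiv ℝ ρ) (hR.differentiableAt_fderiv hx 0).hasFDerivAt η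
  have h2 : HasDerivAt (fun t : ℝ => fderiv ℝ ρ (t • η) ξ) (fderiv ℝ (fderiv ℝ ρ) 0 η ξ) 0 :=
    (ContinuousLinearMap.apply ℝ E ξ).hasFDerivAt.comp_hasDerivAt 0 h1
  have h3 := (hR.hasDerivAt_comp_ray hx hP η).clm_apply h2
  -- The vector `Dρ(tη) ξ` is tangent at `ρ(tη)`, hence fixed by the projector there; the two
  -- derivatives of this curve at `0` are compared.
  have h4 : (fun t : ℝ => (tangentSpace M (R x (t • (η : E)))).starProjection
      (fderiv ℝ ρ (t • η) ξ)) = fun t : ℝ => fderiv ℝ ρ (t • η) ξ := by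
    funext t
    exact Submodule.starProjection_eq_self_iff.2 (hR.fderiv_mem_tangentSpace hx (t • η) ξ)
  rw [h4] at h3
  have h5 := h3.unique h2
  rw [zero_smul, zero_smul, hR.map_zero x hx, hR.starProjection_fderiv_fderiv_zero hx, add_zero,
    hR.fderiv_zero hx] at h5
  exact h5

/-- Each projector is self-adjoint, and this passes to derivatives along a ray. -/
theorem inner_fderivWithin_starProjection_comm (hR : IsSecondOrderRetraction M R) (hx : x ∈ M)
    {P' : E →L[ℝ] E →L[ℝ] E}
    (hP : HasFDerivWithinAt (fun y => (tangentSpace M y).starProjection) P' M x)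
    (η : tangentSpace M x) (u v : E) : inner ℝ u (P' η v) = inner ℝ (P' η u) v := by
  have h := hR.hasDerivAt_comp_ray hx hP η
  have h1 : ∀ w : E, HasDerivAt (fun t : ℝ => (tangentSpace M (R x (t • (η : E)))).starProjection w)
      (P' η w) 0 := fun w => (ContinuousLinearMap.apply ℝ E w).hasFDerivAt.comp_hasDerivAt 0 h
  have h2 := (hasDerivAt_const (0 : ℝ) u).inner ℝ (h1 v)
  have h3 := (h1 u).inner ℝ (hasDerivAt_const (0 : ℝ) v)
  simp only [Submodule.inner_starProjection_left_eq_right] at h3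
  have := h2.unique h3
  simpa using this

theorem twiceDifferentiableAt_pullback (hR : IsSecondOrderRetraction M R) (hx : x ∈ M)
    (hf : TwiceDifferentiableAt f x) : TwiceDifferentiableAt (pullback M R f x) 0 := by
  refine TwiceDifferentiableAt.comp (ρ := fun η : tangentSpace M x => R x (η : E)) ?_
    (Eventually.of_forall ((hR.contDiff hx).differentiable (by simp)))
    (hR.differentiableAt_fderiv hx 0)
  rwa [Submodule.coe_zero, hR.map_zero x hx]

theorem inner_hessian_pullback (hR : IsSecondOrderRetraction M R) (hx : x ∈ M)
    (hf : TwiceDifferentiableAt f x) (ξ η : tangentSpace M x) :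
    inner ℝ ξ (hessian (pullback M R f x) 0 η) =
      inner ℝ (gradient f x)
        (fderiv ℝ (fderiv ℝ (fun η : tangentSpace M x => R x (η : E))) 0 η ξ) +
      inner ℝ (ξ : E) (hessian f x η) := by
  have h0 : R x ((0 : tangentSpace M x) : E) = x := by
    rw [Submodule.coe_zero, hR.map_zero x hx]
  have h := inner_hessian_comp (f := f) (ρ := fun η : tangentSpace M x => R x (η : E)) (η := 0)
    (by rwa [h0]) (Eventually.of_forall ((hR.contDiff hx).differentiable (by simp)))
    (hR.differentiableAt_fderiv hx 0) ξ η
  rw [h0, hR.fderiv_zero hx] at h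
  exact h

/-- For a second-order retraction, the Hessian of the pullback is the Riemannian Hessian. -/
theorem hessian_pullback_eq_riemHess (hR : IsSecondOrderRetraction M R) (hx : x ∈ M)
    (hP : DifferentiableOn ℝ (fun y => (tangentSpace M y).starProjection) M)
    (hf : TwiceDifferentiableAt f x) :
    hessian (pullback M R f x) 0 = riemHess M f x := by
  ext1 η
  refine ext_inner_left ℝ fun ξ => ?_
  have hP' := (hP x hx).hasFDerivWithinAt
  -- Derivatives within `M` are not unique on `E`, so both sides are identified as the derivative of
  -- one curve, `grad f` along a ray.
  have hD : fderivWithin ℝ (fun y => (riemGrad M f y : E)) M x (η : E) =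
      (tangentSpace M x).starProjection (hessian f x η) +
        fderivWithin ℝ (fun y => (tangentSpace M y).starProjection) M x η (gradient f x) := by
    have h1 := hR.hasDerivAt_comp_ray hx (differentiableWithinAt_riemGrad hP hx hf).hasFDerivWithinAt η
    have h2 := hP'.clm_apply hf.hasFDerivAt_gradient.hasFDerivWithinAt
    have h3 := hR.hasDerivAt_comp_ray hx h2 η
    simp only [← coe_riemGrad] at h3
    exact h1.unique h3
  have hH : riemHess M f x η = (tangentSpace M x).orthogonalProjectionOnto
      (fderivWithin ℝ (fun y => (riemGrad M f y : E)) M x (η : E)) := rfl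
  have hproj : ∀ u : E, inner ℝ (ξ : E) ((tangentSpace M x).starProjection u) =
      inner ℝ (ξ : E) u := fun u => by
    rw [← Submodule.inner_starProjection_left_eq_right,
      Submodule.starProjection_eq_self_iff.2 ξ.2]
  rw [hH, hR.inner_hessian_pullback hx hf, Submodule.coe_inner,
    Submodule.coe_orthogonalProjectionOnto_apply, hproj, hD, inner_add_right, hproj,
    hR.inner_fderivWithin_starProjection_comm hx hP',
    hR.fderivWithin_starProjection_apply hx hP', add_comm,
    real_inner_comm (gradient f x)]

end IsSecondOrderRetraction

end Hessian

/-! ### Combining the two expansions -/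

section Expansion

/-- Combining a second-order expansion of `f` at `x` with a second-order expansion
`y = x + η + w / 2 + r` of a curve. -/
theorem abs_sub_le_of_curve_expansion {E : Type*} [NormedAddCommGroup E] [InnerProductSpace ℝ E]
    {H : E →L[ℝ] E} {h η w g : E} {Δ K C G D : ℝ} (hK : 0 ≤ K) (hC : 0 ≤ C)
    (hΔ : |Δ - (inner ℝ g h + 1 / 2 * inner ℝ h (H h))| ≤ K * ‖h‖ ^ 3)
    (hη : ‖η‖ ≤ 1) (hw : ‖w‖ ≤ C * ‖η‖ ^ 2) (hr : ‖h - (η + (1 / 2 : ℝ) • w)‖ ≤ C * ‖η‖ ^ 3)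
    (hg : ‖g‖ ≤ G) (hH : ‖H‖ ≤ D) :
    |Δ - (inner ℝ g η + 1 / 2 * (inner ℝ g w + inner ℝ η (H η)))| ≤
      (K * (1 + 2 * C) ^ 3 + G * C + D * (2 * C) * (2 + 2 * C)) * ‖η‖ ^ 3 := by
  have hη0 := norm_nonneg η
  have hG : 0 ≤ G := (norm_nonneg _).trans hg
  have hD : 0 ≤ D := (norm_nonneg _).trans hH
  have ha32 : ‖η‖ ^ 3 ≤ ‖η‖ ^ 2 := pow_le_pow_of_le_one hη0 hη (by norm_num)
  have ha21 : ‖η‖ ^ 2 ≤ ‖η‖ := pow_le_of_le_one hη0 hη (by norm_num)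
  obtain ⟨r, hrdef⟩ : ∃ r, r = h - (η + (1 / 2 : ℝ) • w) := ⟨_, rfl⟩
  -- The deviation `v = h - η` is of second order: `C/2 + C ≤ 2 * C` bounds its coefficient.
  obtain ⟨v, hv⟩ : ∃ v, v = (1 / 2 : ℝ) • w + r := ⟨_, rfl⟩
  rw [← hrdef] at hr
  have hhv : h = η + v := by rw [hv, hrdef]; abel
  have hvn : ‖v‖ ≤ 2 * C * ‖η‖ ^ 2 := by
    have h1 : ‖v‖ ≤ 1 / 2 * ‖w‖ + ‖r‖ := by
      rw [hv]
      refine (norm_add_le _ _).trans ?_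
      rw [norm_smul]
      norm_num
    have h2 : C * ‖η‖ ^ 3 ≤ C * ‖η‖ ^ 2 := by gcongr
    have h3 : 0 ≤ C * ‖η‖ ^ 2 := by positivity
    linarith
  have hhn : ‖h‖ ≤ (1 + 2 * C) * ‖η‖ := by
    have h1 : ‖h‖ ≤ ‖η‖ + ‖v‖ := hhv ▸ norm_add_le _ _
    have h2 : 2 * C * ‖η‖ ^ 2 ≤ 2 * C * ‖η‖ := by gcongr
    linarith
  have hHle : ∀ u : E, ‖H u‖ ≤ D * ‖u‖ := fun u => H.le_of_opNorm_le hH u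
  have e1 : inner ℝ g h = inner ℝ g η + 1 / 2 * inner ℝ g w + inner ℝ g r := by
    rw [hhv, hv, inner_add_right, inner_add_right, real_inner_smul_right]
    ring
  have e2 : inner ℝ h (H h) = inner ℝ η (H η) + inner ℝ v (H h) + inner ℝ η (H v) := by
    have : inner ℝ h (H h) = inner ℝ η (H h) + inner ℝ v (H h) := by
      nth_rewrite 1 [hhv]
      exact inner_add_left _ _ _
    rw [this]
    nth_rewrite 1 [hhv]
    rw [map_add, inner_add_right]
    ring
  have b1 : |inner ℝ g r| ≤ G * C * ‖η‖ ^ 3 := by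
    calc |inner ℝ g r| ≤ ‖g‖ * ‖r‖ := abs_real_inner_le_norm _ _
      _ ≤ G * (C * ‖η‖ ^ 3) := by gcongr
      _ = _ := by ring
  have b2 : |inner ℝ v (H h)| ≤ D * (2 * C) * (1 + 2 * C) * ‖η‖ ^ 3 := by
    calc |inner ℝ v (H h)| ≤ ‖v‖ * ‖H h‖ := abs_real_inner_le_norm _ _
      _ ≤ (2 * C * ‖η‖ ^ 2) * (D * ((1 + 2 * C) * ‖η‖)) := by
        gcongr
        exact (hHle h).trans (by gcongr)
      _ = _ := by ring
  have b3 : |inner ℝ η (H v)| ≤ D * (2 * C) * ‖η‖ ^ 3 := by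
    calc |inner ℝ η (H v)| ≤ ‖η‖ * ‖H v‖ := abs_real_inner_le_norm _ _
      _ ≤ ‖η‖ * (D * (2 * C * ‖η‖ ^ 2)) := by
        gcongr
        exact (hHle v).trans (by gcongr)
      _ = _ := by ring
  have b0 : |Δ - (inner ℝ g h + 1 / 2 * inner ℝ h (H h))| ≤ K * (1 + 2 * C) ^ 3 * ‖η‖ ^ 3 := by
    calc _ ≤ K * ‖h‖ ^ 3 := hΔ
      _ ≤ K * ((1 + 2 * C) * ‖η‖) ^ 3 := by gcongr
      _ = _ := by ring
  rw [e1, e2] at b0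
  rw [abs_le] at *
  -- The bounds `b2` and `b3` enter with a factor `1/2`; nonnegativity lets their full sum `D * (2 *
  -- C) * (2 + 2 * C)` serve as the constant.
  have b4 : 0 ≤ D * (2 * C) * (1 + 2 * C) * ‖η‖ ^ 3 := by positivity
  have b5 : 0 ≤ D * (2 * C) * ‖η‖ ^ 3 := by positivity
  constructor <;> linarith

end Expansion

end RiemSub

end

theorem lemma3p1 {E : Type*} [NormedAddCommGroup E] [InnerProductSpace ℝ E]
    [FiniteDimensional ℝ E] (d : ℕ) (M : Set E) (hM : IsSmoothSubmanifold d M)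
    (hMc : IsCompact M) (R : E → E → E) (hR : IsSecondOrderRetraction M R)
    (f : E → ℝ) (hf : HasLipschitzHessianOn f (convexHull ℝ M)) :
    ∃ L : ℝ, 0 ≤ L ∧ ∀ x ∈ M,
      TwiceDifferentiableAt (pullback M R f x) 0 ∧
      DifferentiableWithinAt ℝ (fun y => (riemGrad M f y : E)) M x ∧
      hessian (pullback M R f x) 0 = riemHess M f x ∧
      ∀ η : tangentSpace M x,
        |pullback M R f x η -
            (f x + inner ℝ η (riemGrad M f x) +
              1 / 2 * inner ℝ η (hessian (pullback M R f x) 0 η))| ≤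
          L / 6 * ‖η‖ ^ 3 := by
  obtain ⟨hf2, K, hK⟩ := hf
  have hsub : M ⊆ convexHull ℝ M := subset_convexHull ℝ M
  have hP := differentiableOn_starProjection_tangentSpace hM
  obtain ⟨C, hC0, hC⟩ := hR.exists_iteratedDeriv_ray_le hM hMc 3
  obtain ⟨B, hB⟩ := hMc.exists_bound_of_continuousOn (f := f) fun x hx =>
    (hf2 x (hsub hx)).differentiableAt.continuousAt.continuousWithinAt
  obtain ⟨G, hG⟩ := hMc.exists_bound_of_continuousOn (f := gradient f) fun x hx =>
    (hf2 x (hsub hx)).2.continuousAt.continuousWithinAt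
  obtain ⟨D, hD⟩ := hMc.exists_bound_of_continuousOn (hK.continuousOn.mono hsub)
  -- `A` serves `‖η‖ ≤ 1` and `A'` serves `‖η‖ ≥ 1`. The absolute values keep `L` nonnegative even
  -- if `M` is empty, when the signs of `B`, `G`, `D` are unknown; the `6` cancels that of `L / 6`.
  set A : ℝ := K * (1 + 2 * C) ^ 3 + G * C + D * (2 * C) * (2 + 2 * C) with hA
  set A' : ℝ := 2 * B + G + G * C + D with hA'
  refine ⟨6 * (|A| + |A'|), by positivity, fun x hx => ?_⟩
  have hfx := hf2 x (hsub hx)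
  refine ⟨hR.twiceDifferentiableAt_pullback hx hfx, differentiableWithinAt_riemGrad hP hx hfx,
    hR.hessian_pullback_eq_riemHess hx hP hfx, fun η => ?_⟩
  have hyM : R x η ∈ M := hR.mapsTo x hx η η.2
  have hgx := hG x hx
  have hDx := hD x hx
  have hG0 : 0 ≤ G := (norm_nonneg _).trans hgx
  have hD0 : 0 ≤ D := (norm_nonneg _).trans hDx
  set w : E := iteratedDeriv 2 (fun t : ℝ => R x (t • (η : E))) 0 with hw
  have hwn : ‖w‖ ≤ C * ‖η‖ ^ 2 := hC x hx η 0 (by simp) 2 (by norm_num)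
  rw [hR.inner_hessian_pullback hx hfx, ← hR.iteratedDeriv_two_ray hx, ← hw, inner_riemGrad_right]
  have hre : pullback M R f x η - (f x + inner ℝ (gradient f x) (η : E) +
      1 / 2 * (inner ℝ (gradient f x) w + inner ℝ (η : E) (hessian f x η))) =
      (f (R x η) - f x) - (inner ℝ (gradient f x) (η : E) +
        1 / 2 * (inner ℝ (gradient f x) w + inner ℝ (η : E) (hessian f x η))) := by
    rw [pullback]
    ring
  rw [hre, mul_div_cancel_left₀ _ (by norm_num : (6 : ℝ) ≠ 0), Submodule.coe_norm]
  rw [Submodule.coe_norm] at hwn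
  have hη0 := norm_nonneg (η : E)
  rcases le_total ‖(η : E)‖ 1 with h1 | h1
  · have htaylor := norm_sub_taylor_two_le (hR.contDiff_ray hx η) (B := C * ‖(η : E)‖ ^ 3)
      fun t ht => by
        refine hC x hx η t ?_ 3 le_rfl
        rw [norm_smul, Real.norm_of_nonneg ht.1]
        exact mul_le_one₀ ht.2 (norm_nonneg _) h1
    rw [(hR.hasDerivAt_ray hx η).deriv, ← hw, one_smul, zero_smul, hR.map_zero x hx] at htaylor
    -- The segment from `x` to `R x η` may leave `M`, but not its convex hull.
    have hfy := abs_sub_taylor_two_le (convex_convexHull ℝ M) hf2 hK (hsub hx) (hsub hyM)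
    refine (abs_sub_le_of_curve_expansion (h := R x η - x) (C := C) K.coe_nonneg hC0 ?_ h1 hwn ?_
      hgx hDx).trans ?_
    · convert hfy using 2
      ring
    · convert htaylor using 2
      abel
    · exact mul_le_mul_of_nonneg_right
        ((le_abs_self A).trans (le_add_of_nonneg_right (abs_nonneg A'))) (by positivity)
  -- Far from `0` no cancellation is needed: powers of `‖η‖` below the third are at most `‖η‖ ^ 3`.
  · have hfy := hB _ hyM
    have hfx' := hB _ hx
    have hB0 : 0 ≤ B := (norm_nonneg _).trans hfx'
    have ha12 : ‖(η : E)‖ ≤ ‖(η : E)‖ ^ 3 := le_self_pow₀ h1 (by norm_num)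
    have ha23 : ‖(η : E)‖ ^ 2 ≤ ‖(η : E)‖ ^ 3 := pow_le_pow_right₀ h1 (by norm_num)
    have ha03 : 1 ≤ ‖(η : E)‖ ^ 3 := one_le_pow₀ h1
    have b1 : |inner ℝ (gradient f x) (η : E)| ≤ G * ‖(η : E)‖ ^ 3 :=
      (abs_real_inner_le_norm _ _).trans (by gcongr)
    have b2 : |inner ℝ (gradient f x) w| ≤ G * C * ‖(η : E)‖ ^ 3 := by
      calc |inner ℝ (gradient f x) w| ≤ ‖gradient f x‖ * ‖w‖ := abs_real_inner_le_norm _ _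
        _ ≤ G * (C * ‖(η : E)‖ ^ 3) := by
          gcongr
          exact hwn.trans (by gcongr)
        _ = _ := by ring
    have b3 : |inner ℝ (η : E) (hessian f x η)| ≤ D * ‖(η : E)‖ ^ 3 := by
      calc |inner ℝ (η : E) (hessian f x η)| ≤ ‖(η : E)‖ * ‖hessian f x η‖ :=
            abs_real_inner_le_norm _ _
        _ ≤ ‖(η : E)‖ * (D * ‖(η : E)‖) := by
          gcongr
          exact (hessian f x).le_of_opNorm_le hDx _
        _ = D * ‖(η : E)‖ ^ 2 := by ring
        _ ≤ _ := by gcongr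
    have b4 : B ≤ B * ‖(η : E)‖ ^ 3 := le_mul_of_one_le_right hB0 ha03
    have b5 : 0 ≤ G * C * ‖(η : E)‖ ^ 3 := by positivity
    have b6 : 0 ≤ D * ‖(η : E)‖ ^ 3 := by positivity
    have hle : A' * ‖(η : E)‖ ^ 3 ≤ (|A| + |A'|) * ‖(η : E)‖ ^ 3 := by
      gcongr
      exact (le_abs_self A').trans (le_add_of_nonneg_left (abs_nonneg _))
    refine le_trans ?_ hle
    rw [Real.norm_eq_abs] at hfy hfx'
    rw [abs_le] at *
    rw [hA']
    constructor <;> linarith
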